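/- Let $E$ be a finite-dimensional real inner product space (for instance $\mathbb{R}^d$ with $\langle\theta,x\rangle=\theta^\top x$), let $\Omega\subseteq E$ be a set with non-empty interior, and let $\mathcal P=\{P_\theta:\theta\in\Omega\}$ be a natural exponential family of probability distributions on $E$, i.e. $dP_\theta(x)=\exp(\langle\theta,x\rangle-\psi(\theta))\,dH(x)$ for all $\theta\in\Omega$, for a $\sigma$-finite measure $H$ on $E$ and a function $\psi:\Omega\to\mathbb{R}$. (This covers every full-rank natural exponential family with density $\exp(\theta^\top x-\psi(\theta))h(x)$ with respect to a dominating measure $\nu$: take $dH=h\,d\nu$.) Let $K\ge 1$, let $\mathcal X_1,\dots,\mathcal X_K$ be measurable spaces, and suppose that $\mathcal P$ is thinned by a measurable function $T:\mathcal X_1\times\dots\times\mathcal X_K\to E$: there are probability distributions $G_t$ ($t\in E$) on $\mathcal X_1\times\dots\times\mathcal X_K$, depending measurably on $t$ and not depending on $\theta$, such that for every $\theta\in\Omega$, when $X\sim P_\theta$ and $(X^{(1)},\dots,X^{(K)})\mid X$ is sampled from $G_X$, the variables $X^{(1)},\dots,X^{(K)}$ are mutually independent and $X=T(X^{(1)},\dots,X^{(K)})$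 almost surely. Let $Q^{(k)}_\theta$ denote the distribution of $X^{(k)}$ when $X\sim P_\theta$. Then there are measurable functions $T^{(k)}:\mathcal X_k\to E$, $k=1,\dots,K$, not depending on $\theta$, such that: 1. For every $\theta\in\Omega$, $T(x^{(1)},\dots,x^{(K)})=\sum_{k=1}^K T^{(k)}(x^{(k)})$ for almost every $(x^{(1)},\dots,x^{(K)})$ with respect to the joint distribution of $(X^{(1)},\dots,X^{(K)})$ under $\theta$. 2. For every $\theta\in\Omega$, $(X^{(1)},\dots,X^{(K)})\sim Q^{(1)}_\theta\times\dots\times Q^{(K)}_\theta$, and for each $k$ the family $\{Q^{(k)}_\theta:\theta\in\Omega\}$ is an exponential family with sufficient statistic $T^{(k)}$ and natural parameter $\theta$: there are a $\sigma$-finite measure $H_k$ on $\mathcal X_k$ and a function $\psi_k:\Omega\to\mathbb{R}$ with $dQ^{(k)}_\theta(x)=\exp(\langle\theta,T^{(k)}(x)\rangle-\psi_k(\theta))\,dH_k(x)$ for all $\theta\in\Omega$. -/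

import Mathlib

open MeasureTheory ProbabilityTheory
open scoped ENNReal RealInnerProductSpace

/-- `Q = {Q θ : θ ∈ Ω}` is an exponential family of probability distributions on `𝓨` with
natural parameter `η θ` and sufficient statistic `S`:
`dQ_θ(y) = exp(⟪η(θ), S(y)⟫ - ψ(θ)) dH(y)` for a carrier measure `H` (not depending on `θ`). -/
def IsExponentialFamily {Θ 𝓨 E : Type*} [MeasurableSpace 𝓨]
    [NormedAddCommGroup E] [InnerProductSpace ℝ E] [MeasurableSpace E]
    (Ω : Set Θ) (Q : Θ → Measure 𝓨) (η : Θ → E) (S : 𝓨 → E) : Prop :=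
  Measurable S ∧ ∃ (H : Measure 𝓨) (ψ : Θ → ℝ), SigmaFinite H ∧
    ∀ θ ∈ Ω, IsProbabilityMeasure (Q θ) ∧
      Q θ = H.withDensity (fun y => ENNReal.ofReal (Real.exp (⟪η θ, S y⟫ - ψ θ)))

/-- `P = {P θ : θ ∈ Ω}` is a natural exponential family on `E`:
`dP_θ(x) = exp(⟪θ, x⟫ - ψ(θ)) dH(x)`. -/
def IsNaturalExponentialFamily {E : Type*}
    [NormedAddCommGroup E] [InnerProductSpace ℝ E] [MeasurableSpace E]
    (Ω : Set E) (P : E → Measure E) : Prop :=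
  IsExponentialFamily Ω P (fun θ => θ) (fun x => x)

/-- The joint distribution of `(X⁽¹⁾, …, X⁽ᴷ⁾)` when `X ∼ P` and, given `X`, the tuple
`(X⁽¹⁾, …, X⁽ᴷ⁾)` is sampled from `G_X`. -/
noncomputable def partsLaw {E : Type*} [MeasurableSpace E] {K : ℕ} {𝓧 : Fin K → Type*}
    [∀ k, MeasurableSpace (𝓧 k)] (P : Measure E) (G : Kernel E (∀ k, 𝓧 k)) :
    Measure (∀ k, 𝓧 k) :=
  G ∘ₘ P

/-- The distribution of the single part `X⁽ᵏ⁾`. -/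
noncomputable def partLaw {E : Type*} [MeasurableSpace E] {K : ℕ} {𝓧 : Fin K → Type*}
    [∀ k, MeasurableSpace (𝓧 k)] (P : Measure E) (G : Kernel E (∀ k, 𝓧 k)) (k : Fin K) :
    Measure (𝓧 k) :=
  (partsLaw P G).map (fun x => x k)

/-- The family `P = {P θ : θ ∈ Ω}` is thinned by the function `T`, with sampling mechanism
`G = (G_t)` not depending on `θ`: if `X ∼ P θ` and `(X⁽¹⁾, …, X⁽ᴷ⁾) | X` is sampled from `G_X`,
then the `X⁽ᵏ⁾` are mutually independent and `X = T(X⁽¹⁾, …, X⁽ᴷ⁾)` almost surely. -/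
structure IsThinnedBy {Θ E : Type*} [MeasurableSpace E] {K : ℕ} {𝓧 : Fin K → Type*}
    [∀ k, MeasurableSpace (𝓧 k)] (Ω : Set Θ) (P : Θ → Measure E)
    (T : (∀ k, 𝓧 k) → E) (G : Kernel E (∀ k, 𝓧 k)) : Prop where
  isProbabilityMeasure : ∀ θ ∈ Ω, IsProbabilityMeasure (P θ)
  isMarkovKernel : IsMarkovKernel G
  measurable : Measurable T
  indep : ∀ θ ∈ Ω, iIndepFun (fun (k : Fin K) (x : ∀ k, 𝓧 k) => x k) (partsLaw (P θ) G)
  reconstruct : ∀ θ ∈ Ω, ∀ᵐ z ∂(P θ ⊗ₘ G), z.1 = T z.2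

/-! Fix `θ₀` interior to `Ω`. Because `T` recovers `X` almost surely, the density `exp(⟪θ - θ₀, x⟫ +
c)` of `P θ` against `P θ₀` lifts to the joint laws of the parts, with `T x` in place of `x`
(`comp_withDensity_of_ae_eq`). Both joint laws are products, so this density is the product of the
marginal densities, and its logarithm makes `⟪θ - θ₀, T⟫` a sum of functions of single coordinates
(`exists_eq_sum_of_pi_eq_withDensity_exp`). As `θ₀` is interior, `θ - θ₀` can point along every
vector of an orthonormal basis, so `T` itself is additive. Substituting this back factorizes the
density, and each marginal becomes an exponential tilt (`exists_eq_withDensity_exp_of_pi_eq`). -/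

section ProductDensities

variable {ι : Type*} [Fintype ι] {𝓧 : ι → Type*} [∀ i, MeasurableSpace (𝓧 i)]

/-- On a box the integrand is a product of functions of independent coordinates, so its integral
factorizes. -/
lemma MeasureTheory.Measure.pi_withDensity {ν : ∀ i, Measure (𝓧 i)}
    [∀ i, IsProbabilityMeasure (ν i)] {f : ∀ i, 𝓧 i → ℝ≥0∞} (hf : ∀ i, Measurable (f i))
    [∀ i, SigmaFinite ((ν i).withDensity (f i))] :
    Measure.pi (fun i => (ν i).withDensity (f i)) =
      (Measure.pi ν).withDensity (fun x => ∏ i, f i (x i)) := by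
  classical
  refine Measure.pi_eq fun s hs => ?_
  have hm : ∀ i, Measurable ((s i).indicator (f i)) := fun i => (hf i).indicator (hs i)
  have hind : ∀ x : ∀ i, 𝓧 i, (Set.univ.pi s).indicator (fun x => ∏ i, f i (x i)) x =
      ∏ i, (s i).indicator (f i) (x i) := by
    intro x
    by_cases hx : x ∈ Set.univ.pi s
    · rw [Set.indicator_of_mem hx]
      exact Finset.prod_congr rfl fun i _ => (Set.indicator_of_mem (hx i trivial) _).symm
    · rw [Set.indicator_of_notMem hx]
      simp only [Set.mem_pi, Set.mem_univ, true_implies, not_forall] at hx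
      obtain ⟨i, hi⟩ := hx
      exact (Finset.prod_eq_zero (Finset.mem_univ i) (Set.indicator_of_notMem hi _)).symm
  rw [withDensity_apply _ (MeasurableSet.univ_pi hs),
    ← lintegral_indicator (MeasurableSet.univ_pi hs), lintegral_congr hind,
    lintegral_prod_eq_prod_lintegral_of_indepFun Finset.univ
      (fun i (x : ∀ i, 𝓧 i) => (s i).indicator (f i) (x i))
      (iIndepFun_pi fun i => (hm i).aemeasurable)
      (fun i => (hm i).comp (measurable_pi_apply i))]
  refine Finset.prod_congr rfl fun i _ => ?_
  rw [(measurePreserving_eval ν i).lintegral_comp (hm i), lintegral_indicator (hs i),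
    withDensity_apply _ (hs i)]

/-- The log-density of one product probability measure with respect to another is additive. -/
lemma exists_eq_sum_of_pi_eq_withDensity_exp {μ ν : ∀ i, Measure (𝓧 i)}
    [∀ i, IsProbabilityMeasure (μ i)] [∀ i, IsProbabilityMeasure (ν i)]
    {u : (∀ i, 𝓧 i) → ℝ} (hu : Measurable u)
    (h : Measure.pi μ = (Measure.pi ν).withDensity (fun x => ENNReal.ofReal (Real.exp (u x)))) :
    ∃ f : ∀ i, 𝓧 i → ℝ, (∀ i, Measurable (f i)) ∧
      ∀ᵐ x ∂(Measure.pi ν), u x = ∑ i, f i (x i) := by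
  have hac : ∀ i, μ i ≪ ν i := fun i => by
    have h1 : Measure.pi μ ≪ Measure.pi ν := h ▸ withDensity_absolutelyContinuous _ _
    have h2 := h1.map (measurable_pi_apply i)
    rwa [(measurePreserving_eval μ i).map_eq, (measurePreserving_eval ν i).map_eq] at h2
  have hr : ∀ i, (ν i).withDensity ((μ i).rnDeriv (ν i)) = μ i := fun i =>
    Measure.withDensity_rnDeriv_eq _ _ (hac i)
  have hsf : ∀ i, SigmaFinite ((ν i).withDensity ((μ i).rnDeriv (ν i))) := fun i => by
    rw [hr i]; infer_instance
  have hpi := Measure.pi_withDensity (ν := ν) (f := fun i => (μ i).rnDeriv (ν i))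
    (fun i => Measure.measurable_rnDeriv _ _)
  simp only [hr] at hpi
  have hm : Measurable fun x : ∀ i, 𝓧 i => ∏ i, (μ i).rnDeriv (ν i) (x i) :=
    Finset.measurable_fun_prod _ fun i _ =>
      (Measure.measurable_rnDeriv (μ i) (ν i)).comp (measurable_pi_apply i)
  rw [h, withDensity_eq_iff_of_sigmaFinite (by fun_prop) hm.aemeasurable] at hpi
  refine ⟨fun i y => Real.log ((μ i).rnDeriv (ν i) y).toReal, fun i => by fun_prop, ?_⟩
  filter_upwards [hpi] with x hx
  have hx' : Real.exp (u x) = ∏ i, ((μ i).rnDeriv (ν i) (x i)).toReal := by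
    rw [← ENNReal.toReal_prod, ← hx, ENNReal.toReal_ofReal (Real.exp_pos _).le]
  -- The product equals an exponential, so no factor vanishes; this also excludes infinite
  -- densities, whose `toReal` is `0`.
  rw [← Real.log_prod, ← hx', Real.log_exp]
  exact Finset.prod_ne_zero_iff.1 (hx' ▸ (Real.exp_pos _).ne')

/-- The marginals of an exponential tilting of a product probability measure along an additive
function are exponential tiltings of the marginals. -/
lemma exists_eq_withDensity_exp_of_pi_eq {μ ν : ∀ i, Measure (𝓧 i)}
    [∀ i, IsProbabilityMeasure (μ i)] [∀ i, IsProbabilityMeasure (ν i)]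
    {f : ∀ i, 𝓧 i → ℝ} (hf : ∀ i, Measurable (f i)) (c : ℝ)
    (h : Measure.pi μ = (Measure.pi ν).withDensity
      (fun x => ENNReal.ofReal (Real.exp (∑ i, f i (x i) + c)))) (i : ι) :
    ∃ a : ℝ, μ i = (ν i).withDensity (fun y => ENNReal.ofReal (Real.exp (f i y - a))) := by
  classical
  have hm : ∀ i, Measurable fun y => ENNReal.ofReal (Real.exp (f i y)) := fun i => by
    have := hf i
    fun_prop
  have hpi := Measure.pi_withDensity (ν := ν) hm
  have hsplit : ∀ x : ∀ i, 𝓧 i, ENNReal.ofReal (Real.exp (∑ i, f i (x i) + c)) =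
      ENNReal.ofReal (Real.exp c) * ∏ i, ENNReal.ofReal (Real.exp (f i (x i))) := fun x => by
    rw [← ENNReal.ofReal_prod_of_nonneg fun _ _ => (Real.exp_pos _).le, ← Real.exp_sum,
      ← ENNReal.ofReal_mul (Real.exp_pos _).le, ← Real.exp_add, add_comm]
  have hm' : Measurable fun x : ∀ i, 𝓧 i => ∏ i, ENNReal.ofReal (Real.exp (f i (x i))) :=
    Finset.measurable_prod _ fun i _ => (hm i).comp (measurable_pi_apply i)
  have hμ : Measure.pi μ = ENNReal.ofReal (Real.exp c) •
      Measure.pi fun i => (ν i).withDensity fun y => ENNReal.ofReal (Real.exp (f i y)) := by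
    rw [h, hpi, ← withDensity_smul _ hm']
    exact congrArg _ (funext hsplit)
  -- `b` is `exp c` times the masses of the other factors, which might be `0` or `∞` a priori. Total
  -- mass one of `μ i` rules out both values of `b`.
  obtain ⟨b, hb⟩ : ∃ b : ℝ≥0∞, μ i =
      b • (ν i).withDensity fun y => ENNReal.ofReal (Real.exp (f i y)) := by
    have h1 := congrArg (Measure.map (Function.eval i)) hμ
    rw [(measurePreserving_eval μ i).map_eq, Measure.map_smul, Measure.pi_map_eval,
      smul_smul] at h1
    exact ⟨_, h1⟩
  have hone : b * (ν i).withDensity (fun y => ENNReal.ofReal (Real.exp (f i y))) Set.univ = 1 := by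
    rw [← smul_eq_mul, ← Measure.smul_apply, ← hb, measure_univ]
  have hb0 : b ≠ 0 := by
    rintro rfl
    simp at hone
  have hbt : b ≠ ∞ := by
    rintro rfl
    rw [ENNReal.top_mul'] at hone
    split_ifs at hone <;> simp at hone
  refine ⟨-Real.log b.toReal, ?_⟩
  rw [hb, ← withDensity_smul _ (hm i)]
  congr 1
  ext y
  rw [sub_neg_eq_add, Real.exp_add, Real.exp_log (ENNReal.toReal_pos hb0 hbt), mul_comm,
    ENNReal.ofReal_mul ENNReal.toReal_nonneg, ENNReal.ofReal_toReal hbt]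
  rfl

end ProductDensities

/-- If `t` can be recovered almost surely from a draw of `G t`, then a density of the mixing
measure is carried over to the mixture. -/
lemma ProbabilityTheory.Kernel.comp_withDensity_of_ae_eq {α β : Type*} [MeasurableSpace α]
    [MeasurableSpace β] {P : Measure α} [SFinite P] {G : Kernel α β} [IsSFiniteKernel G]
    {T : β → α} (hT : Measurable T) (h : ∀ᵐ z ∂(P ⊗ₘ G), z.1 = T z.2) {g : α → ℝ≥0∞}
    (hg : Measurable g) :
    G ∘ₘ (P.withDensity g) = (G ∘ₘ P).withDensity (fun y => g (T y)) := by
  ext s hs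
  have hGs : Measurable fun a => G a s := G.measurable_coe hs
  have hgT : Measurable (s.indicator fun y => g (T y)) := (hg.comp hT).indicator hs
  rw [Measure.bind_apply hs G.aemeasurable, lintegral_withDensity_eq_lintegral_mul _ hg hGs,
    withDensity_apply _ hs, ← lintegral_indicator hs, ← Measure.snd_compProd, Measure.snd,
    MeasureTheory.lintegral_map hgT measurable_snd]
  -- Reconstruction replaces `g (T z.2)` by `g z.1`, which leaves the inner integral as a constant.
  have hae : (fun z : α × β => s.indicator (fun y => g (T y)) z.2) =ᵐ[P ⊗ₘ G]
      fun z => g z.1 * s.indicator 1 z.2 := by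
    filter_upwards [h] with z hz
    by_cases hzs : z.2 ∈ s <;> simp [hzs, hz]
  have hs1 : Measurable (s.indicator (1 : β → ℝ≥0∞)) := measurable_one.indicator hs
  rw [lintegral_congr_ae hae, Measure.lintegral_compProd (by fun_prop)]
  refine lintegral_congr fun a => ?_
  simp only [Pi.mul_apply]
  rw [lintegral_const_mul _ hs1, lintegral_indicator_one hs]

lemma withDensity_exp_add {α : Type*} [MeasurableSpace α] (μ : Measure α) {u v : α → ℝ}
    (hu : Measurable u) (hv : Measurable v) :
    μ.withDensity (fun x => ENNReal.ofReal (Real.exp (u x + v x))) =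
      (μ.withDensity fun x => ENNReal.ofReal (Real.exp (u x))).withDensity
        fun x => ENNReal.ofReal (Real.exp (v x)) := by
  rw [← withDensity_mul _ (by fun_prop) (by fun_prop)]
  congr 1
  ext x
  rw [Pi.mul_apply, ← ENNReal.ofReal_mul (Real.exp_pos _).le, Real.exp_add]

/-- A function all of whose components along an orthonormal basis are almost everywhere additive
is itself almost everywhere additive. -/
lemma exists_eq_sum_of_inner_eq_sum {E ι κ : Type*} [NormedAddCommGroup E] [InnerProductSpace ℝ E]
    [MeasurableSpace E] [BorelSpace E] [Fintype ι] [Fintype κ] [FiniteDimensional ℝ E]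
    {𝓧 : κ → Type*} [∀ k, MeasurableSpace (𝓧 k)] {ν : Measure (∀ k, 𝓧 k)} {T : (∀ k, 𝓧 k) → E}
    (b : OrthonormalBasis ι ℝ E)
    (h : ∀ i, ∃ f : ∀ k, 𝓧 k → ℝ, (∀ k, Measurable (f k)) ∧
      ∀ᵐ x ∂ν, ⟪b i, T x⟫ = ∑ k, f k (x k)) :
    ∃ S : ∀ k, 𝓧 k → E, (∀ k, Measurable (S k)) ∧ ∀ᵐ x ∂ν, T x = ∑ k, S k (x k) := by
  choose f hf hfe using h
  refine ⟨fun k y => ∑ i, f i k y • b i, fun k => ?_, ?_⟩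
  · exact Finset.measurable_fun_sum _ fun i _ => (hf i k).smul_const _
  · filter_upwards [ae_all_iff.2 hfe] with x hx
    rw [← b.sum_repr' (T x), Finset.sum_comm]
    exact Finset.sum_congr rfl fun i _ => by rw [hx i, Finset.sum_smul]

theorem theorem3 {E : Type*} [NormedAddCommGroup E] [InnerProductSpace ℝ E]
    [FiniteDimensional ℝ E] [MeasurableSpace E] [BorelSpace E]
    {K : ℕ} (hK : 1 ≤ K) {𝓧 : Fin K → Type*} [∀ k, MeasurableSpace (𝓧 k)]
    (Ω : Set E) (hΩ : (interior Ω).Nonempty)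
    (P : E → Measure E) (hP : IsNaturalExponentialFamily Ω P)
    (T : (∀ k, 𝓧 k) → E) (G : Kernel E (∀ k, 𝓧 k)) (hT : IsThinnedBy Ω P T G) :
    ∃ S : ∀ k, 𝓧 k → E,
      (∀ θ ∈ Ω, ∀ᵐ x ∂(partsLaw (P θ) G), T x = ∑ k, S k (x k)) ∧
      (∀ θ ∈ Ω, partsLaw (P θ) G = Measure.pi (fun k => partLaw (P θ) G k)) ∧
      (∀ k, IsExponentialFamily Ω (fun θ => partLaw (P θ) G k) (fun θ => θ) (S k)) := by
  obtain ⟨-, H, ψ, -, hPH⟩ := hP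
  obtain ⟨θ₀, hθ₀⟩ := hΩ
  have hθ₀Ω : θ₀ ∈ Ω := interior_subset hθ₀
  have := hT.isMarkovKernel
  have hTm := hT.measurable
  have hprob : ∀ θ ∈ Ω, IsProbabilityMeasure (partsLaw (P θ) G) := fun θ hθ => by
    have := hT.isProbabilityMeasure θ hθ
    unfold partsLaw
    infer_instance
  have hprob' : ∀ θ ∈ Ω, ∀ k, IsProbabilityMeasure (partLaw (P θ) G k) := fun θ hθ k => by
    have := hprob θ hθ
    exact Measure.isProbabilityMeasure_map (measurable_pi_apply k).aemeasurable
  have hpi : ∀ θ ∈ Ω, partsLaw (P θ) G = Measure.pi (fun k => partLaw (P θ) G k) := by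
    intro θ hθ
    have := hprob θ hθ
    have h := (iIndepFun_iff_map_fun_eq_pi_map
      (fun k => (measurable_pi_apply k).aemeasurable)).1 (hT.indep θ hθ)
    exact Measure.map_id.symm.trans h
  have hdens : ∀ θ ∈ Ω, partsLaw (P θ) G = (partsLaw (P θ₀) G).withDensity
      fun x => ENNReal.ofReal (Real.exp (⟪θ - θ₀, T x⟫ + (ψ θ₀ - ψ θ))) := by
    intro θ hθ
    have := hT.isProbabilityMeasure θ₀ hθ₀Ω
    have hPθ : P θ = (P θ₀).withDensity
        fun x => ENNReal.ofReal (Real.exp (⟪θ - θ₀, x⟫ + (ψ θ₀ - ψ θ))) := by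
      rw [(hPH θ hθ).2, (hPH θ₀ hθ₀Ω).2, ← withDensity_exp_add _ (by fun_prop) (by fun_prop)]
      congr! 4 with x
      rw [inner_sub_left]
      ring_nf
    unfold partsLaw
    rw [hPθ]
    exact Kernel.comp_withDensity_of_ae_eq hTm (hT.reconstruct θ₀ hθ₀Ω) (by fun_prop)
  have hadd : ∀ θ ∈ Ω, ∃ f : ∀ k, 𝓧 k → ℝ, (∀ k, Measurable (f k)) ∧
      ∀ᵐ x ∂(partsLaw (P θ₀) G), ⟪θ - θ₀, T x⟫ = ∑ k, f k (x k) := by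
    intro θ hθ
    have := hprob' θ hθ
    have := hprob' θ₀ hθ₀Ω
    have h := hdens θ hθ
    rw [hpi θ hθ, hpi θ₀ hθ₀Ω] at h
    obtain ⟨f, hf, hfe⟩ := exists_eq_sum_of_pi_eq_withDensity_exp (by fun_prop) h
    -- The normalizing constant is spread evenly over the `K` coordinates; this needs `K ≠ 0`.
    refine ⟨fun k y => f k y - (ψ θ₀ - ψ θ) / K, fun k => (hf k).sub_const _, ?_⟩
    rw [hpi θ₀ hθ₀Ω]
    filter_upwards [hfe] with x hx
    have hK' : (K : ℝ) ≠ 0 := by positivity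
    rw [Finset.sum_sub_distrib, ← hx, Finset.sum_const, Finset.card_univ, Fintype.card_fin,
      nsmul_eq_mul, mul_div_cancel₀ _ hK', add_sub_cancel_right]
  obtain ⟨ε, hε, hball⟩ := Metric.isOpen_iff.1 isOpen_interior θ₀ hθ₀
  have hmem : ∀ i, θ₀ + (ε / 2) • stdOrthonormalBasis ℝ E i ∈ Ω := fun i => by
    refine interior_subset (hball ?_)
    rw [Metric.mem_ball, dist_eq_norm, add_sub_cancel_left, norm_smul, OrthonormalBasis.norm_eq_one,
      mul_one, Real.norm_of_nonneg (by positivity)]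
    exact half_lt_self hε
  obtain ⟨S, hSm, hS⟩ := exists_eq_sum_of_inner_eq_sum (ν := partsLaw (P θ₀) G) (T := T)
    (stdOrthonormalBasis ℝ E) fun i => by
      obtain ⟨f, hf, hfe⟩ := hadd _ (hmem i)
      refine ⟨fun k y => (ε / 2)⁻¹ * f k y, fun k => (hf k).const_mul _, ?_⟩
      filter_upwards [hfe] with x hx
      rw [add_sub_cancel_left, real_inner_smul_left] at hx
      rw [← Finset.mul_sum, ← hx, inv_mul_cancel_left₀ (by positivity)]
  refine ⟨S, fun θ hθ => ?_, hpi, fun k => ⟨hSm k, ?_⟩⟩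
  · rw [hdens θ hθ]
    -- One null set under `θ₀` serves every `θ`.
    exact withDensity_absolutelyContinuous _ _ hS
  have htilt : ∀ θ ∈ Ω, ∃ a : ℝ, partLaw (P θ) G k = (partLaw (P θ₀) G k).withDensity
      fun y => ENNReal.ofReal (Real.exp (⟪θ - θ₀, S k y⟫ - a)) := by
    intro θ hθ
    have := hprob' θ hθ
    have := hprob' θ₀ hθ₀Ω
    have hSinner : ∀ k, Measurable fun y => ⟪θ - θ₀, S k y⟫ := fun k =>
      measurable_const.inner (hSm k)
    refine exists_eq_withDensity_exp_of_pi_eq (μ := fun k => partLaw (P θ) G k)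
      (ν := fun k => partLaw (P θ₀) G k) hSinner (ψ θ₀ - ψ θ) ?_ k
    rw [← hpi θ hθ, ← hpi θ₀ hθ₀Ω, hdens θ hθ]
    refine withDensity_congr_ae ?_
    filter_upwards [hS] with x hx
    rw [hx, inner_sum]
  choose! a ha using htilt
  have := hprob' θ₀ hθ₀Ω k
  -- The factor `exp(-⟪θ₀, S k y⟫)` absorbed in the carrier turns the tilt by `θ - θ₀` into one by
  -- `θ`.
  refine ⟨(partLaw (P θ₀) G k).withDensity
    fun y => ENNReal.ofReal (Real.exp (-⟪θ₀, S k y⟫)), a, inferInstance,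
    fun θ hθ => ⟨hprob' θ hθ k, ?_⟩⟩
  have hin : ∀ η : E, Measurable fun y => ⟪η, S k y⟫ := fun η => measurable_const.inner (hSm k)
  have h := withDensity_exp_add (partLaw (P θ₀) G k) (u := fun y => -⟪θ₀, S k y⟫)
    (hin θ₀).neg ((hin θ).sub_const (a θ))
  refine Eq.trans ?_ h
  beta_reduce
  rw [ha θ hθ]
  congr! 4 with y
  rw [inner_sub_left]
  ring
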